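/- Let $F$ be a field with $\operatorname{char}(F)\neq 2$ and let $A$ be an associative (not necessarily unital) $F$-algebra with center $Z(A)$. Suppose that $A$ is noncommutative and prime, i.e., the product of any two nonzero (two-sided) ideals of $A$ is nonzero. Suppose that $M$ is the unique minimal ideal of $A$, i.e., a nonzero ideal of $A$ that is contained in every nonzero ideal of $A$. Write $[x,y]=xy-yx$, and let $[M,A]$ be the linear span of all $[m,a]$ with $m\in M$, $a\in A$. A Lie ideal of $A$ is a linear subspace $L$ of $A$ such that $[x,a]\in L$ for all $x\in L$, $a\in A$; it is noncentral if $L\not\subseteq Z(A)$. Then $[M,A]$ is the unique minimal noncentral Lie ideal of $A$, i.e., $[M,A]$ is a noncentral Lie ideal of $A$ and it is contained in every noncentral Lie ideal of $A$. -/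

import Mathlib

namespace HersteinLie

section

variable (F : Type*) {A : Type*} [Field F] [NonUnitalRing A] [Module F A]

/-- A (two-sided) ideal of a not necessarily unital `F`-algebra `A`: a subspace closed under
multiplication by elements of `A` on either side. -/
def IsAlgIdeal (I : Submodule F A) : Prop :=
  ∀ x ∈ I, ∀ a : A, a * x ∈ I ∧ x * a ∈ I

/-- The product `I J`: the linear span of all `x * y` with `x ∈ I`, `y ∈ J`. -/
def idealProd (I J : Submodule F A) : Submodule F A :=
  Submodule.span F {z : A | ∃ x ∈ I, ∃ y ∈ J, z = x * y}

variable (A) in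
/-- `A` is prime: the product of any two nonzero ideals is nonzero. -/
def IsPrimeAlg : Prop :=
  ∀ I J : Submodule F A, IsAlgIdeal F I → IsAlgIdeal F J → I ≠ ⊥ → J ≠ ⊥ → idealProd F I J ≠ ⊥

/-- `M` is the unique minimal ideal of `A`: a nonzero ideal contained in every nonzero ideal. -/
def IsUniqueMinimalIdeal (M : Submodule F A) : Prop :=
  IsLeast {I : Submodule F A | IsAlgIdeal F I ∧ I ≠ ⊥} M

/-- A Lie ideal of `A`: a subspace `L` with `[L, A] ⊆ L`, where `⁅x, a⁆ = x * a - a * x`. -/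
def IsLieIdeal (L : Submodule F A) : Prop :=
  ∀ x ∈ L, ∀ a : A, ⁅x, a⁆ ∈ L

/-- A noncentral Lie ideal: a Lie ideal that is not a subset of the center of `A`. -/
def IsNoncentralLieIdeal (L : Submodule F A) : Prop :=
  IsLieIdeal F L ∧ ¬ (L : Set A) ⊆ Set.center A

/-- `[M, A]`: the linear span of all commutators `⁅m, a⁆` with `m ∈ M`, `a ∈ A`. -/
def commutatorSpan (M : Submodule F A) : Submodule F A :=
  Submodule.span F {z : A | ∃ m ∈ M, ∃ a : A, z = ⁅m, a⁆}

end

end HersteinLie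

/-!
Let `L` be a noncentral Lie ideal. In a semiprime ring without `2`-torsion a derivation of square
zero vanishes, so `[L, L] ≠ 0`: otherwise `[u, [u, a]] = 0` for `u ∈ L`, making `u` central.
Following Herstein, consider `T = {x | [x, A] ⊆ L}`, which is both a subalgebra and a Lie ideal
containing `L`. For `u, v ∈ T` the identities `[u, v] a = [u, v a] - v [u, a]` and
`b [u, v] a = [u, v] a b - [[u, v] a, b]` put the ideal `A [u, v] A` inside `T`. Choosing
`u, v ∈ L` with `[u, v] ≠ 0` gives a nonzero ideal `I` with `[I, A] ⊆ L`, and minimality yields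
`M ⊆ I`. If `[M, A]` were central, then `[m, [m, a]] = 0` would make `M` central, which is
impossible for a nonzero ideal of a noncommutative prime algebra.
-/

namespace HersteinLie

section Ring

variable {A : Type*} [NonUnitalRing A]

theorem mem_center_iff_forall_lie_eq_zero {u : A} :
    u ∈ Set.center A ↔ ∀ a : A, ⁅u, a⁆ = 0 := by
  simp only [Semigroup.mem_center_iff, Ring.lie_def, sub_eq_zero, eq_comm]

theorem lie_mul_eq_add (u a b : A) : ⁅u, a * b⁆ = ⁅u, a⁆ * b + a * ⁅u, b⁆ := by
  simp only [Ring.lie_def]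
  noncomm_ring

theorem mul_lie_eq_add_cyclic (x y a : A) : ⁅x * y, a⁆ = ⁅x, y * a⁆ + ⁅y, a * x⁆ := by
  simp only [Ring.lie_def]
  noncomm_ring

variable (A) in
/-- Semiprimeness of a ring in its elementwise form, which makes sense without a unit:
`x A x = 0` only for `x = 0`. -/
def IsSemiprime : Prop :=
  ∀ x : A, (∀ a : A, x * a * x = 0) → x = 0

namespace IsSemiprime

theorem derivation_eq_zero_of_sq_eq_zero (hA : IsSemiprime A) (h2 : IsSMulRegular A 2)
    {d : A →+ A} (leibniz : ∀ a b : A, d (a * b) = d a * b + a * d b)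
    (hd : ∀ a : A, d (d a) = 0) : d = 0 := by
  have mul_eq_zero (a b : A) : d a * d b = 0 := by
    refine h2.right_eq_zero_of_smul ?_
    calc 2 • (d a * d b) = d (d (a * b)) := by
          simp only [leibniz, map_add, hd, zero_mul, mul_zero, zero_add, add_zero, two_nsmul]
      _ = 0 := hd _
  ext a
  refine hA (d a) fun c => ?_
  calc d a * c * d a = d a * d (c * a) - d a * d c * a := by
        rw [leibniz, mul_add, mul_assoc, mul_assoc, add_sub_cancel_left]
    _ = 0 := by rw [mul_eq_zero, mul_eq_zero, zero_mul, sub_zero]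

theorem mem_center_of_lie_lie_eq_zero (hA : IsSemiprime A) (h2 : IsSMulRegular A 2) {u : A}
    (hu : ∀ a : A, ⁅u, ⁅u, a⁆⁆ = 0) : u ∈ Set.center A := by
  let d : A →+ A := AddMonoidHom.mulLeft u - AddMonoidHom.mulRight u
  have hd : d = 0 := hA.derivation_eq_zero_of_sq_eq_zero h2 (lie_mul_eq_add u) hu
  exact mem_center_iff_forall_lie_eq_zero.mpr (DFunLike.congr_fun hd)

end IsSemiprime

end Ring

section Ideal

variable {F A : Type*} [Field F] [NonUnitalRing A] [Module F A]

theorem isAlgIdeal_top : IsAlgIdeal F (⊤ : Submodule F A) :=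
  fun _ _ _ => ⟨Submodule.mem_top, Submodule.mem_top⟩

theorem IsAlgIdeal.lie_mem {I : Submodule F A} (hI : IsAlgIdeal F I) {m : A} (hm : m ∈ I)
    (a : A) : ⁅m, a⁆ ∈ I :=
  sub_mem (hI m hm a).2 (hI m hm a).1

theorem IsPrimeAlg.eq_bot_or_eq_bot (h : IsPrimeAlg F A) {I J : Submodule F A}
    (hI : IsAlgIdeal F I) (hJ : IsAlgIdeal F J) (hIJ : ∀ x ∈ I, ∀ y ∈ J, x * y = 0) :
    I = ⊥ ∨ J = ⊥ := by
  by_contra! hne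
  refine h I J hI hJ hne.1 hne.2 (Submodule.span_eq_bot.mpr ?_)
  rintro _ ⟨x, hx, y, hy, rfl⟩
  exact hIJ x hx y hy

variable (F) in
/-- The ideal `A x A`, the span of all products `a * x * b`. As `A` need not have a unit, it need
not contain `x`. -/
def sandwichIdeal (x : A) : Submodule F A :=
  Submodule.span F {z : A | ∃ a b : A, z = a * x * b}

theorem IsSemiprime.sandwichIdeal_ne_bot (hA : IsSemiprime A) {x : A} (hx : x ≠ 0) :
    sandwichIdeal F x ≠ ⊥ := by
  intro hbot
  have sandwich_eq_zero (a b : A) : a * x * b = 0 :=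
    Submodule.span_eq_bot.mp hbot _ ⟨a, b, rfl⟩
  refine hx (hA x fun c => hA (x * c * x) fun b => ?_)
  rw [sandwich_eq_zero (x * c) b, zero_mul]

variable (F) in
/-- The right annihilator `{x | S x = 0}` of a subset `S` of an algebra. -/
def rightAnnihilator [SMulCommClass F A A] (S : Set A) : Submodule F A where
  carrier := {x | ∀ s ∈ S, s * x = 0}
  zero_mem' := fun s _ => mul_zero s
  add_mem' := fun hx hy s hs => by rw [mul_add, hx s hs, hy s hs, add_zero]
  smul_mem' := fun c x hx s hs => by rw [mul_smul_comm, hx s hs, smul_zero]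

theorem isAlgIdeal_rightAnnihilator [SMulCommClass F A A] {S : Set A}
    (hS : ∀ s ∈ S, ∀ a : A, s * a ∈ S) : IsAlgIdeal F (rightAnnihilator F S) := by
  refine fun x hx a => ⟨fun s hs => ?_, fun s hs => ?_⟩
  · rw [← mul_assoc, hx _ (hS s hs a)]
  · rw [← mul_assoc, hx s hs, zero_mul]

variable [IsScalarTower F A A]

variable (F) in
/-- The left annihilator `{x | x S = 0}` of a subset `S` of an algebra. -/
def leftAnnihilator (S : Set A) : Submodule F A where
  carrier := {x | ∀ s ∈ S, x * s = 0}
  zero_mem' := fun s _ => zero_mul s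
  add_mem' := fun hx hy s hs => by rw [add_mul, hx s hs, hy s hs, add_zero]
  smul_mem' := fun c x hx s hs => by rw [smul_mul_assoc, hx s hs, smul_zero]

theorem isAlgIdeal_leftAnnihilator {S : Set A} (hS : ∀ s ∈ S, ∀ a : A, a * s ∈ S) :
    IsAlgIdeal F (leftAnnihilator F S) := by
  refine fun x hx a => ⟨fun s hs => ?_, fun s hs => ?_⟩
  · rw [mul_assoc, hx s hs, mul_zero]
  · rw [mul_assoc, hx _ (hS s hs a)]

theorem IsPrimeAlg.leftAnnihilator_eq_bot (h : IsPrimeAlg F A) {J : Submodule F A}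
    (hJ : IsAlgIdeal F J) (hne : J ≠ ⊥) : leftAnnihilator F (J : Set A) = ⊥ :=
  (h.eq_bot_or_eq_bot (isAlgIdeal_leftAnnihilator fun s hs a => (hJ s hs a).1) hJ
    fun _ hx => hx).resolve_right hne

variable [SMulCommClass F A A]

theorem isAlgIdeal_sandwichIdeal (x : A) : IsAlgIdeal F (sandwichIdeal F x) := by
  intro z hz c
  induction hz using Submodule.span_induction with
  | mem z hz =>
    obtain ⟨a, b, rfl⟩ := hz
    exact ⟨Submodule.subset_span ⟨c * a, b, by simp only [mul_assoc]⟩,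
      Submodule.subset_span ⟨a, b * c, by simp only [mul_assoc]⟩⟩
  | zero => simp only [mul_zero, zero_mul, zero_mem, and_self]
  | add y z _ _ hy hz =>
    rw [mul_add, add_mul]
    exact ⟨add_mem hy.1 hz.1, add_mem hy.2 hz.2⟩
  | smul r z _ hz =>
    rw [mul_smul_comm, smul_mul_assoc]
    exact ⟨Submodule.smul_mem _ r hz.1, Submodule.smul_mem _ r hz.2⟩

namespace IsPrimeAlg

theorem eq_zero_or_eq_zero_of_forall_mul_mul_eq_zero (h : IsPrimeAlg F A) {x y : A}
    (hxy : ∀ a : A, x * a * y = 0) : x = 0 ∨ y = 0 := by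
  refine or_iff_not_imp_right.mpr fun hy => ?_
  let J : Submodule F A := rightAnnihilator F (Set.range (x * ·))
  have hJ : IsAlgIdeal F J := isAlgIdeal_rightAnnihilator <| by
    rintro _ ⟨a, rfl⟩ b
    exact ⟨a * b, (mul_assoc x a b).symm⟩
  have hyJ : y ∈ J := Set.forall_mem_range.mpr hxy
  have mul_eq_zero (a : A) : x * a = 0 := by
    rw [← Submodule.mem_bot F,
      ← h.leftAnnihilator_eq_bot hJ ((Submodule.ne_bot_iff J).mpr ⟨y, hyJ, hy⟩)]
    exact fun z hz => hz _ ⟨a, rfl⟩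
  have htop : (⊤ : Submodule F A) ≠ ⊥ :=
    (Submodule.ne_bot_iff _).mpr ⟨y, Submodule.mem_top, hy⟩
  rw [← Submodule.mem_bot F, ← h.leftAnnihilator_eq_bot isAlgIdeal_top htop]
  exact fun a _ => mul_eq_zero a

theorem isSemiprime (h : IsPrimeAlg F A) : IsSemiprime A :=
  fun _ hx => or_self_iff.mp (h.eq_zero_or_eq_zero_of_forall_mul_mul_eq_zero hx)

theorem eq_bot_of_subset_center (h : IsPrimeAlg F A) (hnc : ∃ x y : A, x * y ≠ y * x)
    {I : Submodule F A} (hI : IsAlgIdeal F I) (hc : (I : Set A) ⊆ Set.center A) : I = ⊥ := by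
  obtain ⟨x, y, hxy⟩ := hnc
  have lie_eq_zero {m : A} (hm : m ∈ I) : ∀ a : A, ⁅m, a⁆ = 0 :=
    mem_center_iff_forall_lie_eq_zero.mp (hc hm)
  have mul_lie_eq_zero {m : A} (hm : m ∈ I) : m * ⁅x, y⁆ = 0 := by
    calc m * ⁅x, y⁆ = ⁅m * x, y⁆ - ⁅m, y⁆ * x := by
          simp only [Ring.lie_def]
          noncomm_ring
      _ = 0 := by rw [lie_eq_zero (hI m hm x).2, lie_eq_zero hm, zero_mul, sub_zero]
  refine (Submodule.eq_bot_iff I).mpr fun m hm => ?_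
  exact (h.eq_zero_or_eq_zero_of_forall_mul_mul_eq_zero
    fun a => mul_lie_eq_zero (hI m hm a).2).resolve_right (sub_ne_zero.mpr hxy)

end IsPrimeAlg

end Ideal

section LieIdeal

variable {F A : Type*} [Field F] [NonUnitalRing A] [Module F A]

theorem lie_mem_commutatorSpan {I : Submodule F A} {m : A} (hm : m ∈ I) (a : A) :
    ⁅m, a⁆ ∈ commutatorSpan F I :=
  Submodule.subset_span ⟨m, hm, a, rfl⟩

theorem commutatorSpan_le {I L : Submodule F A} :
    commutatorSpan F I ≤ L ↔ ∀ m ∈ I, ∀ a : A, ⁅m, a⁆ ∈ L := by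
  refine ⟨fun h m hm a => h (lie_mem_commutatorSpan hm a), fun h => Submodule.span_le.mpr ?_⟩
  rintro _ ⟨m, hm, a, rfl⟩
  exact h m hm a

theorem commutatorSpan_mono {I J : Submodule F A} (hIJ : I ≤ J) :
    commutatorSpan F I ≤ commutatorSpan F J :=
  commutatorSpan_le.mpr fun _ hm => lie_mem_commutatorSpan (hIJ hm)

theorem IsAlgIdeal.isLieIdeal_commutatorSpan {I : Submodule F A} (hI : IsAlgIdeal F I) :
    IsLieIdeal F (commutatorSpan F I) := by
  have hle : commutatorSpan F I ≤ I := commutatorSpan_le.mpr fun _ => hI.lie_mem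
  exact fun x hx => lie_mem_commutatorSpan (hle hx)

theorem IsNoncentralLieIdeal.exists_lie_ne_zero {L : Submodule F A}
    (hL : IsNoncentralLieIdeal F L) (hA : IsSemiprime A) (h2 : IsSMulRegular A 2) :
    ∃ u ∈ L, ∃ v ∈ L, ⁅u, v⁆ ≠ 0 := by
  by_contra! hLL
  exact hL.2 fun u hu =>
    hA.mem_center_of_lie_lie_eq_zero h2 fun a => hLL u hu _ (hL.1 u hu a)

theorem sandwichIdeal_lie_le {T : NonUnitalSubalgebra F A} (hT : IsLieIdeal F T.toSubmodule)
    {u v : A} (hu : u ∈ T) (hv : v ∈ T) : sandwichIdeal F ⁅u, v⁆ ≤ T.toSubmodule := by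
  have lie_mul_mem (a : A) : ⁅u, v⁆ * a ∈ T := by
    rw [← sub_eq_of_eq_add (lie_mul_eq_add u v a)]
    exact sub_mem (hT u hu (v * a)) (mul_mem hv (hT u hu a))
  refine Submodule.span_le.mpr ?_
  rintro _ ⟨b, a, rfl⟩
  have mul_lie_mul : b * ⁅u, v⁆ * a = ⁅u, v⁆ * (a * b) - ⁅⁅u, v⁆ * a, b⁆ := by
    rw [Ring.lie_def (⁅u, v⁆ * a) b, mul_assoc, mul_assoc, sub_sub_cancel]
  rw [mul_lie_mul]
  exact sub_mem (lie_mul_mem (a * b)) (hT _ (lie_mul_mem a) b)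

variable [IsScalarTower F A A] [SMulCommClass F A A]

/-- Herstein's subalgebra `T(L) = {x | [x, A] ⊆ L}` attached to a subspace `L`. -/
def lieTransporter (L : Submodule F A) : NonUnitalSubalgebra F A where
  carrier := {x | ∀ a : A, ⁅x, a⁆ ∈ L}
  zero_mem' := fun a => by simp only [Ring.lie_def, zero_mul, mul_zero, sub_self, zero_mem]
  add_mem' := fun {x y} hx hy a => by
    have add_lie : ⁅x + y, a⁆ = ⁅x, a⁆ + ⁅y, a⁆ := by
      simp only [Ring.lie_def]
      noncomm_ring
    exact add_lie ▸ add_mem (hx a) (hy a)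
  mul_mem' := fun {x y} hx hy a =>
    mul_lie_eq_add_cyclic x y a ▸ add_mem (hx (y * a)) (hy (a * x))
  smul_mem' := fun c x hx a => by
    have smul_lie : ⁅c • x, a⁆ = c • ⁅x, a⁆ := by
      rw [Ring.lie_def, Ring.lie_def, smul_mul_assoc, mul_smul_comm, smul_sub]
    exact smul_lie ▸ L.smul_mem c (hx a)

theorem IsLieIdeal.le_lieTransporter {L : Submodule F A} (hL : IsLieIdeal F L) :
    L ≤ (lieTransporter L).toSubmodule :=
  hL

theorem IsLieIdeal.isLieIdeal_lieTransporter {L : Submodule F A} (hL : IsLieIdeal F L) :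
    IsLieIdeal F (lieTransporter L).toSubmodule :=
  fun _ hx a => hL.le_lieTransporter (hx a)

theorem IsNoncentralLieIdeal.exists_commutatorSpan_le {L : Submodule F A}
    (hL : IsNoncentralLieIdeal F L) (hA : IsSemiprime A) (h2 : IsSMulRegular A 2) :
    ∃ I : Submodule F A, IsAlgIdeal F I ∧ I ≠ ⊥ ∧ commutatorSpan F I ≤ L := by
  obtain ⟨u, hu, v, hv, huv⟩ := hL.exists_lie_ne_zero hA h2
  refine ⟨sandwichIdeal F ⁅u, v⁆, isAlgIdeal_sandwichIdeal _, hA.sandwichIdeal_ne_bot huv,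
    commutatorSpan_le.mpr ?_⟩
  exact sandwichIdeal_lie_le hL.1.isLieIdeal_lieTransporter
    (hL.1.le_lieTransporter hu) (hL.1.le_lieTransporter hv)

theorem IsPrimeAlg.isNoncentralLieIdeal_commutatorSpan (h : IsPrimeAlg F A)
    (h2 : IsSMulRegular A 2) (hnc : ∃ x y : A, x * y ≠ y * x) {I : Submodule F A}
    (hI : IsAlgIdeal F I) (hne : I ≠ ⊥) : IsNoncentralLieIdeal F (commutatorSpan F I) := by
  refine ⟨hI.isLieIdeal_commutatorSpan, fun hc => hne ?_⟩
  refine h.eq_bot_of_subset_center hnc hI fun m hm => ?_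
  refine h.isSemiprime.mem_center_of_lie_lie_eq_zero h2 fun a => ?_
  have hma : ⁅m, a⁆ ∈ Set.center A := hc (lie_mem_commutatorSpan hm a)
  rw [Ring.lie_def m, sub_eq_zero]
  exact Semigroup.mem_center_iff.mp hma m

end LieIdeal

end HersteinLie

theorem theorem3p2 {F : Type*} [Field F] (hF : ringChar F ≠ 2)
    {A : Type*} [NonUnitalRing A] [Module F A] [IsScalarTower F A A] [SMulCommClass F A A]
    (hprime : HersteinLie.IsPrimeAlg F A) (hnc : ∃ x y : A, x * y ≠ y * x)
    (M : Submodule F A) (hM : HersteinLie.IsUniqueMinimalIdeal F M) :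
    IsLeast {L : Submodule F A | HersteinLie.IsNoncentralLieIdeal F L}
      (HersteinLie.commutatorSpan F M) := by
  have h2 : IsSMulRegular A 2 := .of_right_eq_zero_of_smul fun x hx =>
    (smul_eq_zero.mp ((ofNat_smul_eq_nsmul F 2 x).trans hx)).resolve_left (Ring.two_ne_zero hF)
  obtain ⟨⟨hMI, hM0⟩, hMle⟩ := hM
  refine ⟨hprime.isNoncentralLieIdeal_commutatorSpan h2 hnc hMI hM0, fun L hL => ?_⟩
  obtain ⟨I, hI, hI0, hIL⟩ := hL.exists_commutatorSpan_le hprime.isSemiprime h2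
  exact (HersteinLie.commutatorSpan_mono (hMle ⟨hI, hI0⟩)).trans hIL
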